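/- A tropical meromorphic function is a continuous piecewise linear function $f:\mathbb{R}\to\mathbb{R}$ with arbitrary real slopes, whose points of non-differentiability have no finite limit point. For such $f$ and $x\in\mathbb{R}$ put $\omega_f(x)=\lim_{\varepsilon\to0+}\bigl(f'(x+\varepsilon)-f'(x-\varepsilon)\bigr)$; the point $x$ is a pole of $f$ if $\omega_f(x)<0$. Define, for $r\ge 0$, $$m(r,f)=\tfrac12\bigl(\max\{0,f(r)\}+\max\{0,f(-r)\}\bigr),\qquad n(r,f)=\sum_{|s|\le r,\ \omega_f(s)<0}|\omega_f(s)|,$$ $$N(r,f)=\tfrac12\int_0^r n(t,f)\,dt,\qquad T(r,f)=m(r,f)+N(r,f),$$ and let the hyper-order of $f$ be $\varsigma(f)=\limsup_{r\to\infty}\frac{\log\log T(r,f)}{\log r}$. Write $f\oplus a=\max\{f,a\}$ and $1_\circ\oslash g=-g$. Let $f$ be a non-constant tropical meromorphic function of hyper-order $\varsigma<1$, let $\varepsilon>0$, and let $q\ge1$ distinct values $a_1,\dots,a_q\in\mathbb{R}$ satisfy $$\max\{a_1,\dots,a_q\}<\inf\{f(\alpha):\omega_f(\alpha)<0\},$$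 where the infimum is taken in $[-\infty,+\infty]$ and is $+\infty$ if $f$ has no poles. Then there is a measurable set $E$ with $\int_{E\cap[1,\infty)}\frac{dr}{r}<\infty$ such that $$qT(r,f)=\sum_{k=1}^q N\bigl(r,1_\circ\oslash(f\oplus a_k)\bigr)+o\!\left(\frac{T(r,f)}{r^{1-\varsigma-\varepsilon}}\right)$$ as $r\to\infty$ with $r\notin E$. -/

import Mathlib

open Filter Topology MeasureTheory Asymptotics

noncomputable section

namespace TropicalNevanlinna

/-- The tropical unit element, the real number zero. -/
def tropOne : ℝ := 0

/-- Tropical (max-plus) addition of real numbers. -/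
def tropAdd (a b : ℝ) : ℝ := max a b

/-- Tropical (max-plus) division of real numbers. -/
def tropDiv (a b : ℝ) : ℝ := a - b

/-- A tropical meromorphic function: a continuous piecewise linear function on the real line
with arbitrary real slopes. There is a set `S` of possible break points, finite in every bounded
interval (so without finite limit points), such that `f` is affine near each point outside `S`. -/
structure IsTropicalMeromorphic (f : ℝ → ℝ) : Prop where
  continuous : Continuous f
  piecewise_linear : ∃ S : Set ℝ, (∀ R : ℝ, (S ∩ Set.Icc (-R) R).Finite) ∧
    ∀ x ∉ S, ∃ m : ℝ, ∀ᶠ y in 𝓝 x, f y = f x + m * (y - x)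

/-- The jump of the slope at `x`: the limit of `f' (x + ε) - f' (x - ε)` as `ε` decreases to `0`
(the limit exists at every point when `f` is tropical meromorphic). -/
def omega (f : ℝ → ℝ) (x : ℝ) : ℝ :=
  limUnder (𝓝[>] (0 : ℝ)) (fun ε : ℝ => deriv f (x + ε) - deriv f (x - ε))

/-- The set of poles of `f`. -/
def poles (f : ℝ → ℝ) : Set ℝ := {x | omega f x < 0}

/-- The tropical proximity function `m(r, f)`. -/
def proximity (r : ℝ) (f : ℝ → ℝ) : ℝ := (1 / 2) * (max 0 (f r) + max 0 (f (-r)))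

/-- The unintegrated counting function `n(x, f)`: the number of poles in `[-x, x]`, counted with
multiplicity. The sum is finite when `f` is tropical meromorphic. -/
def poleCount (x : ℝ) (f : ℝ → ℝ) : ℝ := ∑ᶠ s ∈ {s : ℝ | |s| ≤ x ∧ s ∈ poles f}, |omega f s|

/-- The tropical counting function `N(r, f)`. -/
def counting (r : ℝ) (f : ℝ → ℝ) : ℝ := (1 / 2) * ∫ t in (0 : ℝ)..r, poleCount t f

/-- The tropical Nevanlinna characteristic function `T(r, f)`. -/
def characteristic (r : ℝ) (f : ℝ → ℝ) : ℝ := proximity r f + counting r f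

/-- The hyper-order of `f`, as an extended real number. -/
def hyperOrder (f : ℝ → ℝ) : EReal :=
  limsup (fun r : ℝ => ((Real.log (Real.log (characteristic r f)) / Real.log r : ℝ) : EReal)) atTop

/-- `E` is a measurable set of finite logarithmic measure: the integral of `1 / r` over the part
of `E` in `[1, ∞)` is finite. -/
def FiniteLogMeasure (E : Set ℝ) : Prop :=
  MeasurableSet E ∧ ∫⁻ r in E ∩ Set.Ici 1, ENNReal.ofReal (1 / r) < ⊤

end TropicalNevanlinna

end

open TropicalNevanlinna

namespace TropicalNevanlinna

/-! The Jensen formula for `f ⊕ a` expresses `N(r, -(f ⊕ a))` as the mean of `f ⊕ a` at `±r`, minus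
a constant, plus `N(r, f ⊕ a)`. Since `f > a` at every pole, truncation keeps each pole with its
multiplicity and creates none, so `N(r, f ⊕ a) = N(r, f)` (`counting_max`). That mean differs from
`m(r, f)` by at most `|a|`, hence `T(r, f) - N(r, -(f ⊕ a))` is bounded
(`abs_characteristic_sub_counting_le`). A non-constant `f` has `T` at least linear
(`exists_linear_le_characteristic`), which also forces `ς ≥ 0`. Thus `1 - ς - ε < 1` and `T / r ^ (1
- ς - ε) → ∞`, so a bounded error is already little-o, with no exceptional set. -/

/-- `f` is affine with slope `l` just to the left of `x` and with slope `r` just to the right. -/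
def HasSlopes (f : ℝ → ℝ) (x l r : ℝ) : Prop :=
  ∀ᶠ y in 𝓝 x, f y = f x + l * min (y - x) 0 + r * max (y - x) 0

/-! ### One-sided slopes. -/

namespace HasSlopes

variable {f g : ℝ → ℝ} {x l r l' r' : ℝ}

theorem add (hf : HasSlopes f x l r) (hg : HasSlopes g x l' r') :
    HasSlopes (fun y => f y + g y) x (l + l') (r + r') := by
  filter_upwards [hf, hg] with y h₁ h₂
  rw [h₁, h₂]; ring

theorem const_mul (c : ℝ) (hf : HasSlopes f x l r) :
    HasSlopes (fun y => c * f y) x (c * l) (c * r) := by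
  filter_upwards [hf] with y h₁
  rw [h₁]; ring

theorem neg (hf : HasSlopes f x l r) : HasSlopes (fun y => -f y) x (-l) (-r) := by
  filter_upwards [hf] with y h₁
  rw [h₁]; ring

theorem sum {ι : Type*} (F : Finset ι) {f : ι → ℝ → ℝ} {l r : ι → ℝ}
    (h : ∀ i ∈ F, HasSlopes (f i) x (l i) (r i)) :
    HasSlopes (fun y => ∑ i ∈ F, f i y) x (∑ i ∈ F, l i) (∑ i ∈ F, r i) := by
  filter_upwards [(F.eventually_all).2 h] with y hy
  rw [Finset.sum_congr rfl hy, Finset.sum_add_distrib, Finset.sum_add_distrib,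
    Finset.sum_mul, Finset.sum_mul]

/-- The conditions `x ≤ s` and `x < s` disagree only at `x = s`, where the jump is `2`. -/
theorem abs_sub (s x : ℝ) :
    HasSlopes (fun y => |y - s|) x (if x ≤ s then -1 else 1) (if x < s then -1 else 1) := by
  rcases lt_trichotomy x s with h | rfl | h
  · filter_upwards [eventually_lt_nhds h] with y hy
    rw [if_pos h.le, if_pos h, abs_of_neg (by linarith), abs_of_neg (by linarith)]
    linarith [min_add_max (y - x) 0]
  · refine Eventually.of_forall fun y => ?_
    simp only [le_refl, lt_irrefl, if_true, if_false, sub_self, abs_zero]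
    rcases le_total (y - x) 0 with h | h
    · rw [abs_of_nonpos h, min_eq_left h, max_eq_right h]; ring
    · rw [abs_of_nonneg h, min_eq_right h, max_eq_left h]; ring
  · filter_upwards [eventually_gt_nhds h] with y hy
    rw [if_neg (not_le.2 h), if_neg (not_lt.2 h.le), abs_of_pos (by linarith),
      abs_of_pos (by linarith)]
    linarith [min_add_max (y - x) 0]

theorem continuousAt (hf : HasSlopes f x l r) : ContinuousAt f x := by
  have h : ContinuousAt (fun y => f x + l * min (y - x) 0 + r * max (y - x) 0) x := by fun_prop
  exact h.congr (hf.mono fun y hy => hy.symm)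

theorem eventually_right (hf : HasSlopes f x l r) :
    ∀ᶠ y in 𝓝[>] x, HasSlopes f y r r := by
  filter_upwards [hf.eventually_nhds.filter_mono nhdsWithin_le_nhds, self_mem_nhdsWithin]
    with y hy hxy
  have hxy : x < y := hxy
  have e := hy.self_of_nhds
  filter_upwards [hy, eventually_gt_nhds hxy] with z hz hxz
  rw [hz, e, min_eq_right (by linarith), max_eq_left (by linarith),
    min_eq_right (by linarith), max_eq_left (by linarith)]
  linarith [congrArg (r * ·) (min_add_max (z - y) 0)]

theorem eventually_left (hf : HasSlopes f x l r) :
    ∀ᶠ y in 𝓝[<] x, HasSlopes f y l l := by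
  filter_upwards [hf.eventually_nhds.filter_mono nhdsWithin_le_nhds, self_mem_nhdsWithin]
    with y hy hxy
  have hxy : y < x := hxy
  have e := hy.self_of_nhds
  filter_upwards [hy, eventually_lt_nhds hxy] with z hz hxz
  rw [hz, e, min_eq_left (by linarith), max_eq_right (by linarith),
    min_eq_left (by linarith), max_eq_right (by linarith)]
  linarith [congrArg (l * ·) (min_add_max (z - y) 0)]

theorem hasDerivAt (hf : HasSlopes f x l l) : HasDerivAt f l x := by
  have h : HasDerivAt (fun y => f x + l * (y - x)) l x := by
    simpa using (((hasDerivAt_id x).sub_const x).const_mul l).const_add (f x)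
  refine h.congr_of_eventuallyEq (hf.mono fun y hy => ?_)
  simp only
  linarith [congrArg (l * ·) (min_add_max (y - x) 0)]

theorem omega_eq (hf : HasSlopes f x l r) : omega f x = r - l := by
  refine Tendsto.limUnder_eq (tendsto_const_nhds.congr' ?_)
  have t₁ : Tendsto (fun ε : ℝ => x + ε) (𝓝[>] 0) (𝓝[>] x) := by
    refine tendsto_nhdsWithin_iff.2 ⟨?_, ?_⟩
    · have : Tendsto (fun ε : ℝ => x + ε) (𝓝 0) (𝓝 (x + 0)) := by
        apply Continuous.tendsto; fun_prop
      rw [add_zero] at this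
      exact this.mono_left nhdsWithin_le_nhds
    · filter_upwards [self_mem_nhdsWithin] with ε hε
      exact lt_add_of_pos_right x hε
  have t₂ : Tendsto (fun ε : ℝ => x - ε) (𝓝[>] 0) (𝓝[<] x) := by
    refine tendsto_nhdsWithin_iff.2 ⟨?_, ?_⟩
    · have : Tendsto (fun ε : ℝ => x - ε) (𝓝 0) (𝓝 (x - 0)) := by
        apply Continuous.tendsto; fun_prop
      rw [sub_zero] at this
      exact this.mono_left nhdsWithin_le_nhds
    · filter_upwards [self_mem_nhdsWithin] with ε hε
      exact sub_lt_self x hε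
  filter_upwards [t₁.eventually hf.eventually_right, t₂.eventually hf.eventually_left]
    with ε h₁ h₂
  rw [h₁.hasDerivAt.deriv, h₂.hasDerivAt.deriv]

/-- At a crossing `f x = a` the slopes become `min l 0` and `max r 0`, so truncation may create a
convex kink but never a pole. -/
theorem max_const (hf : HasSlopes f x l r) (a : ℝ) :
    ∃ l' r', HasSlopes (fun y => max (f y) a) x l' r' ∧
      ((a < f x ∧ r' - l' = r - l) ∨ (f x ≤ a ∧ 0 ≤ r' - l')) := by
  rcases lt_trichotomy (f x) a with h | h | h
  · refine ⟨0, 0, ?_, Or.inr ⟨h.le, by simp⟩⟩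
    filter_upwards [hf.continuousAt.eventually_lt_const h] with y hy
    rw [max_eq_right hy.le, max_eq_right h.le]; ring
  · refine ⟨min l 0, max r 0, ?_, Or.inr ⟨h.le, ?_⟩⟩
    · filter_upwards [hf] with y hy
      rw [hy, h, max_self]
      rcases le_total (y - x) 0 with hyx | hyx
      · rw [min_eq_left hyx, max_eq_right hyx]
        rcases le_total l 0 with hl | hl
        · rw [min_eq_left hl, max_eq_left]
          · ring
          · nlinarith
        · rw [min_eq_right hl, max_eq_right]
          · ring
          · nlinarith
      · rw [min_eq_right hyx, max_eq_left hyx]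
        rcases le_total r 0 with hr | hr
        · rw [max_eq_right hr, max_eq_right]
          · ring
          · nlinarith
        · rw [max_eq_left hr, max_eq_left]
          · ring
          · nlinarith
    · linarith [min_le_right l 0, le_max_right r 0]
  · refine ⟨l, r, ?_, Or.inl ⟨h, rfl⟩⟩
    filter_upwards [hf.continuousAt.eventually_const_lt h, hf] with y hy hy'
    rw [max_eq_left hy.le, max_eq_left h.le, hy']

end HasSlopes

/-! ### From local slopes to affine formulas. -/

theorem exists_affine_on {f : ℝ → ℝ} {U : Set ℝ} (hU : IsOpen U) (hc : IsPreconnected U)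
    (h : ∀ x ∈ U, ∃ m, HasSlopes f x m m) : ∃ m c, ∀ y ∈ U, f y = m * y + c := by
  have hd : ∀ x ∈ U, ∃ m, ∀ᶠ y in 𝓝 x, HasDerivAt f m y := by
    intro x hx
    obtain ⟨m, hm⟩ := h x hx
    refine ⟨m, ?_⟩
    have e := hm.eventually_right
    have e' := hm.eventually_left
    have e'' : ∀ᶠ y in 𝓝[≠] x, HasDerivAt f m y := by
      rw [← Set.Iio_union_Ioi, nhdsWithin_union, eventually_sup]
      exact ⟨e'.mono fun y hy => hy.hasDerivAt, e.mono fun y hy => hy.hasDerivAt⟩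
    rw [eventually_nhdsWithin_iff] at e''
    filter_upwards [e''] with y hy
    by_cases hyx : y = x
    · exact hyx ▸ hm.hasDerivAt
    · exact hy hyx
  -- The derivative is locally constant, hence constant on the connected set `U`; the same argument
  -- then applies to `f y - m * y`.
  have hdd : ∀ x ∈ U, HasDerivAt (deriv f) 0 x := by
    intro x hx
    obtain ⟨m, hm⟩ := hd x hx
    exact (hasDerivAt_const x m).congr_of_eventuallyEq (hm.mono fun y hy => hy.deriv)
  obtain ⟨m, hm⟩ := hU.exists_is_const_of_deriv_eq_zero hc
    (fun x hx => (hdd x hx).differentiableAt.differentiableWithinAt)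
    (fun x hx => (hdd x hx).deriv)
  have hg : ∀ x ∈ U, HasDerivAt (fun y => f y - m * y) 0 x := by
    intro x hx
    obtain ⟨m', hm'⟩ := hd x hx
    have h₁ := hm'.self_of_nhds
    have : m' = m := by rw [← h₁.deriv, hm x hx]
    subst this
    have h₂ := h₁.fun_sub ((hasDerivAt_id' x).const_mul m')
    rwa [mul_one, sub_self] at h₂
  obtain ⟨c, hc⟩ := hU.exists_is_const_of_deriv_eq_zero hc
    (fun x hx => (hg x hx).differentiableAt.differentiableWithinAt)
    (fun x hx => (hg x hx).deriv)
  exact ⟨m, c, fun y hy => by linarith [hc y hy]⟩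

theorem hasSlopes_self_of_eventually {f : ℝ → ℝ} {x m : ℝ}
    (h : ∀ᶠ y in 𝓝 x, f y = f x + m * (y - x)) : HasSlopes f x m m := by
  filter_upwards [h] with y hy
  rw [hy]
  linarith [congrArg (m * ·) (min_add_max (y - x) 0)]

/-- Local finiteness of `S` leaves a punctured neighbourhood of `x` free of break points; `f` is
affine on each side, and continuity matches both formulas at `x`. -/
theorem IsTropicalMeromorphic.exists_hasSlopes {f : ℝ → ℝ} (hf : IsTropicalMeromorphic f)
    (x : ℝ) : ∃ l r, HasSlopes f x l r := by
  obtain ⟨S, hS, hm⟩ := hf.piecewise_linear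
  have hfin : ((S ∩ Set.Icc (-(|x| + 1)) (|x| + 1)) \ {x}).Finite := (hS _).subset Set.sdiff_subset
  have hnear : ∀ᶠ y in 𝓝 x, y ≠ x → y ∉ S := by
    have hI : Set.Icc (-(|x| + 1)) (|x| + 1) ∈ 𝓝 x := by
      refine Icc_mem_nhds ?_ ?_
      · linarith [neg_abs_le x]
      · linarith [le_abs_self x]
    filter_upwards [hfin.isClosed.isOpen_compl.mem_nhds (by simp), hI] with y hy hyI hyx hyS
    exact hy ⟨⟨hyS, hyI⟩, hyx⟩
  obtain ⟨δ, hδ, hball⟩ := Metric.eventually_nhds_iff_ball.1 hnear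
  rw [Real.ball_eq_Ioo] at hball
  have affine : ∀ a b, Set.Ioo a b ⊆ Set.Ioo (x - δ) (x + δ) → x ∉ Set.Ioo a b →
      ∃ m c, ∀ y ∈ Set.Ioo a b, f y = m * y + c := by
    intro a b hab hx
    refine exists_affine_on isOpen_Ioo isPreconnected_Ioo fun y hy => ?_
    obtain ⟨m, h⟩ := hm y (hball y (hab hy) (fun h => hx (h ▸ hy)))
    exact ⟨m, hasSlopes_self_of_eventually h⟩
  obtain ⟨l, c, hl⟩ := affine (x - δ) x (Set.Ioo_subset_Ioo le_rfl (by linarith)) (by simp)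
  obtain ⟨r, d, hr⟩ := affine x (x + δ) (Set.Ioo_subset_Ioo (by linarith) le_rfl) (by simp)
  have hc := hf.continuous.continuousAt (x := x)
  have hl' : f x = l * x + c := by
    refine tendsto_nhds_unique (f := f) (l := 𝓝[<] x) (hc.mono_left nhdsWithin_le_nhds) ?_
    have : Tendsto (fun y => l * y + c) (𝓝[<] x) (𝓝 (l * x + c)) :=
      (Continuous.tendsto (by fun_prop) x).mono_left nhdsWithin_le_nhds
    refine this.congr' ?_
    filter_upwards [Ioo_mem_nhdsLT (show x - δ < x by linarith)] with y hy
    exact (hl y hy).symm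
  have hr' : f x = r * x + d := by
    refine tendsto_nhds_unique (f := f) (l := 𝓝[>] x) (hc.mono_left nhdsWithin_le_nhds) ?_
    have : Tendsto (fun y => r * y + d) (𝓝[>] x) (𝓝 (r * x + d)) :=
      (Continuous.tendsto (by fun_prop) x).mono_left nhdsWithin_le_nhds
    refine this.congr' ?_
    filter_upwards [Ioo_mem_nhdsGT (show x < x + δ by linarith)] with y hy
    exact (hr y hy).symm
  refine ⟨l, r, ?_⟩
  filter_upwards [Ioo_mem_nhds (show x - δ < x by linarith) (show x < x + δ by linarith)]
    with y hy
  rcases lt_trichotomy y x with h | rfl | h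
  · rw [hl y ⟨hy.1, h⟩, hl', min_eq_left (by linarith), max_eq_right (by linarith)]; ring
  · simp
  · rw [hr y ⟨h, hy.2⟩, hr', min_eq_right (by linarith), max_eq_left (by linarith)]; ring

variable {f : ℝ → ℝ}

/-! ### Break points, counting function and Jensen formula. -/

theorem finite_omega_ne_zero (hf : ∀ x, ∃ l r, HasSlopes f x l r) (R : ℝ) :
    {s | s ∈ Set.Icc (-R) R ∧ omega f s ≠ 0}.Finite := by
  by_contra hinf
  obtain ⟨x, -, hx⟩ := Set.Infinite.exists_accPt_of_subset_isCompact hinf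
    (isCompact_Icc (a := -R) (b := R)) (fun s hs => hs.1)
  rw [accPt_iff_frequently_nhdsNE] at hx
  obtain ⟨l, r, h⟩ := hf x
  refine hx ?_
  rw [← Set.Iio_union_Ioi, nhdsWithin_union, eventually_sup]
  constructor
  · filter_upwards [h.eventually_left] with y hy hy'
    exact hy'.2 (by rw [hy.omega_eq, sub_self])
  · filter_upwards [h.eventually_right] with y hy hy'
    exact hy'.2 (by rw [hy.omega_eq, sub_self])

/-- The kink `omega f s / 2 * |y - s|` has the same jump at `s` as `f`; subtracting all of them
leaves a function without jumps. Superfluous points of `F` carry weight zero. -/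
theorem exists_representation (hf : ∀ x, ∃ l r, HasSlopes f x l r) {R : ℝ} {F : Finset ℝ}
    (hF : ∀ s, |s| < R → omega f s ≠ 0 → s ∈ F) :
    ∃ m c, ∀ y, |y| < R → f y = m * y + c + ∑ s ∈ F, omega f s / 2 * |y - s| := by
  have key : ∀ x ∈ Set.Ioo (-R) R,
      ∃ m, HasSlopes (fun y => f y + (-1) * ∑ s ∈ F, omega f s / 2 * |y - s|) x m m := by
    intro x hx
    obtain ⟨l, r, h⟩ := hf x
    have hs := (HasSlopes.sum F fun s _ =>
      (HasSlopes.abs_sub s x).const_mul (omega f s / 2)).const_mul (-1)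
    have e : ∑ s ∈ F, omega f s / 2 * (if x < s then -1 else 1)
        - ∑ s ∈ F, omega f s / 2 * (if x ≤ s then -1 else 1) = r - l := by
      rw [← h.omega_eq, ← Finset.sum_sub_distrib]
      trans ∑ s ∈ F, if x = s then omega f s else 0
      · refine Finset.sum_congr rfl fun s _ => ?_
        rcases lt_trichotomy x s with h | rfl | h
        · simp [h, h.le, h.ne]
        · simp
        · simp [not_lt.2 h.le, not_le.2 h, h.ne']
      · rw [Finset.sum_ite_eq]
        split_ifs with hxF
        · rfl
        · by_contra hne
          exact hxF (hF x (abs_lt.2 hx) (Ne.symm hne))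
    have ha := h.add hs
    rw [show r + -1 * ∑ s ∈ F, omega f s / 2 * (if x < s then -1 else 1)
      = l + -1 * ∑ s ∈ F, omega f s / 2 * (if x ≤ s then -1 else 1) by linarith] at ha
    exact ⟨_, ha⟩
  obtain ⟨m, c, h⟩ := exists_affine_on isOpen_Ioo isPreconnected_Ioo key
  exact ⟨m, c, fun y hy => by linarith [h y (abs_lt.1 hy)]⟩

/-- A pole `s` is counted from `t = |s|` onwards, hence contributes its multiplicity times `(r -
|s|)⁺` to the integral. -/
theorem counting_eq_sum {r : ℝ} {F : Finset ℝ} (hr : 0 ≤ r)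
    (hF : ∀ s, |s| ≤ r → omega f s ≠ 0 → s ∈ F) :
    counting r f = 1 / 2 * ∑ s ∈ F, max 0 (-omega f s) * max 0 (r - |s|) := by
  have hn : ∀ t ≤ r, poleCount t f = ∑ s ∈ F, if |s| ≤ t then max 0 (-omega f s) else 0 := by
    intro t ht
    unfold poleCount
    rw [finsum_mem_def, finsum_eq_sum_of_support_subset (s := F)]
    · refine Finset.sum_congr rfl fun s _ => ?_
      by_cases hs : |s| ≤ t
      · by_cases hp : omega f s < 0
        · rw [Set.indicator_of_mem (show s ∈ {s | |s| ≤ t ∧ s ∈ poles f} from ⟨hs, hp⟩), if_pos hs, abs_of_neg hp,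
            max_eq_right (by linarith)]
        · rw [Set.indicator_of_notMem (fun h => hp h.2), if_pos hs, max_eq_left (by linarith)]
      · rw [Set.indicator_of_notMem (fun h => hs h.1), if_neg hs]
    · intro s hs
      have h := Set.mem_of_indicator_ne_zero hs
      exact hF s (h.1.trans ht) (ne_of_lt h.2)
  have hint : ∀ s, IntervalIntegrable (fun t => if |s| ≤ t then max 0 (-omega f s) else 0)
      volume 0 r := by
    intro s
    refine MonotoneOn.intervalIntegrable fun a _ b _ hab => ?_
    split_ifs with h₁ h₂ h₂
    · rfl
    · exact absurd (h₁.trans hab) h₂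
    · exact le_max_left _ _
    · rfl
  have hval : ∀ s, ∫ t in (0 : ℝ)..r, (if |s| ≤ t then max 0 (-omega f s) else 0)
      = max 0 (-omega f s) * max 0 (r - |s|) := by
    intro s
    -- The primitive has a corner at `|s|`, which is left out as a countable set.
    rw [integral_eq_of_hasDerivAt_off_countable
      (fun t => max 0 (-omega f s) * max 0 (t - |s|)) _ (Set.countable_singleton |s|)
      (by fun_prop) ?_ (hint s)]
    · simp
    · rintro t ⟨-, ht⟩
      rcases lt_or_gt_of_ne (show t ≠ |s| from ht) with h | h
      · rw [if_neg (not_le.2 h)]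
        refine (hasDerivAt_const t (0 : ℝ)).congr_of_eventuallyEq ?_
        filter_upwards [eventually_lt_nhds h] with u hu
        rw [max_eq_left (show u - |s| ≤ 0 by linarith), mul_zero]
      · rw [if_pos h.le]
        have h₁ := ((hasDerivAt_id' t).sub_const |s|).const_mul (max 0 (-omega f s))
        rw [mul_one] at h₁
        refine h₁.congr_of_eventuallyEq ?_
        filter_upwards [eventually_gt_nhds h] with u hu
        rw [max_eq_right (show 0 ≤ u - |s| by linarith)]
  unfold counting
  rw [intervalIntegral.integral_congr (g := fun t => ∑ s ∈ F, if |s| ≤ t then max 0 (-omega f s) else 0),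
    intervalIntegral.integral_finsetSum fun s _ => hint s]
  · simp only [hval]
  · intro t ht
    rw [Set.uIcc_of_le hr] at ht
    exact hn t ht.2

theorem exists_finset_breaks (hf : ∀ x, ∃ l r, HasSlopes f x l r) (R : ℝ) :
    ∃ F : Finset ℝ, ∀ s, |s| ≤ R → omega f s ≠ 0 → s ∈ F :=
  ⟨(finite_omega_ne_zero hf R).toFinset, fun s hs h => by
    rw [Set.Finite.mem_toFinset]
    exact ⟨abs_le.1 hs, h⟩⟩

theorem exists_hasSlopes_neg (hf : ∀ x, ∃ l r, HasSlopes f x l r) (x : ℝ) :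
    ∃ l r, HasSlopes (fun y => -f y) x l r := by
  obtain ⟨l, r, h⟩ := hf x
  exact ⟨_, _, h.neg⟩

theorem omega_neg (hf : ∀ x, ∃ l r, HasSlopes f x l r) (x : ℝ) :
    omega (fun y => -f y) x = -omega f x := by
  obtain ⟨l, r, h⟩ := hf x
  rw [h.neg.omega_eq, h.omega_eq]; ring

/-- This is the Jensen formula for a single kink. -/
theorem abs_sub_add_abs_neg_sub {r : ℝ} (hr : 0 ≤ r) (s : ℝ) :
    |r - s| + |-r - s| - 2 * |0 - s| = 2 * max 0 (r - |s|) := by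
  rcases abs_cases (r - s) with h₁ | h₁ <;> rcases abs_cases (-r - s) with h₂ | h₂ <;>
    rcases abs_cases (0 - s) with h₃ | h₃ <;> rcases abs_cases s with h₄ | h₄ <;>
    rcases max_cases 0 (r - |s|) with h₅ | h₅ <;> linarith

/-- The tropical Jensen formula. -/
theorem jensen (hf : ∀ x, ∃ l r, HasSlopes f x l r) {r : ℝ} (hr : 0 ≤ r) :
    1 / 2 * (f r + f (-r)) - f 0 = counting r (fun x => -f x) - counting r f := by
  -- The representation holds on an open interval, which has to contain `±r`.
  obtain ⟨F, hF⟩ := exists_finset_breaks hf (r + 1)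
  obtain ⟨m, c, h⟩ := exists_representation hf (R := r + 1) fun s hs => hF s hs.le
  rw [counting_eq_sum hr fun s hs => hF s (by linarith),
    counting_eq_sum (F := F) hr fun s hs h => hF s (by linarith) fun h₀ => h (by
      rw [omega_neg hf, h₀, neg_zero]),
    h r (by rw [abs_of_nonneg hr]; linarith), h (-r) (by rw [abs_neg, abs_of_nonneg hr]; linarith),
    h 0 (by rw [abs_zero]; linarith)]
  have e : ∀ s ∈ F, 1 / 2 * (omega f s / 2 * |r - s| + omega f s / 2 * |-r - s|)
      - omega f s / 2 * |0 - s| = 1 / 2 * (max 0 (-omega (fun x => -f x) s) * max 0 (r - |s|))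
      - 1 / 2 * (max 0 (-omega f s) * max 0 (r - |s|)) := by
    intro s _
    have h₁ := abs_sub_add_abs_neg_sub hr s
    have h₂ : max 0 (omega f s) - max 0 (-omega f s) = omega f s := by
      rcases le_total (omega f s) 0 with h | h
      · rw [max_eq_left h, max_eq_right (by linarith)]; ring
      · rw [max_eq_right h, max_eq_left (by linarith)]; ring
    rw [omega_neg hf, neg_neg]
    linear_combination (omega f s / 4) * h₁ - (max 0 (r - |s|) / 2) * h₂
  have := Finset.sum_congr rfl e
  simp only [Finset.sum_sub_distrib, ← Finset.mul_sum, Finset.sum_add_distrib] at this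
  linarith

/-! ### Growth of the characteristic. -/

theorem counting_nonneg (hf : ∀ x, ∃ l r, HasSlopes f x l r) {r : ℝ} (hr : 0 ≤ r) :
    0 ≤ counting r f := by
  obtain ⟨F, hF⟩ := exists_finset_breaks hf r
  rw [counting_eq_sum hr hF]
  positivity

theorem le_counting (hf : ∀ x, ∃ l r, HasSlopes f x l r) {α r : ℝ} (hα : omega f α < 0)
    (hr : |α| ≤ r) : -omega f α / 2 * (r - |α|) ≤ counting r f := by
  obtain ⟨F, hF⟩ := exists_finset_breaks hf r
  rw [counting_eq_sum ((abs_nonneg α).trans hr) hF]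
  have := Finset.single_le_sum (f := fun s => max 0 (-omega f s) * max 0 (r - |s|))
    (fun s _ => by positivity) (hF α hr hα.ne)
  rw [max_eq_right (by linarith : 0 ≤ -omega f α), max_eq_right (by linarith : 0 ≤ r - |α|)] at this
  linarith

theorem proximity_nonneg (r : ℝ) (f : ℝ → ℝ) : 0 ≤ proximity r f := by
  unfold proximity
  positivity

/-- The characteristic of a non-constant function grows at least linearly. -/
theorem exists_linear_le_characteristic (hf : ∀ x, ∃ l r, HasSlopes f x l r)
    (hconst : ¬ ∃ c : ℝ, ∀ x : ℝ, f x = c) :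
    ∃ c > 0, ∀ᶠ r in atTop, c * r ≤ characteristic r f := by
  suffices h : ∃ c > 0, ∃ C, ∀ᶠ r in atTop, c * r - C ≤ characteristic r f by
    obtain ⟨c, hc, C, h⟩ := h
    refine ⟨c / 2, by linarith, ?_⟩
    filter_upwards [h, (tendsto_id.const_mul_atTop (half_pos hc)).eventually_ge_atTop C]
      with r h₁ h₂
    simp only [id] at h₂
    linarith
  by_cases hp : ∃ α, omega f α < 0
  · obtain ⟨α, hα⟩ := hp
    refine ⟨-omega f α / 2, by linarith, -omega f α / 2 * |α|, ?_⟩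
    filter_upwards [eventually_ge_atTop |α|] with r hr
    have := le_counting hf hα hr
    have := proximity_nonneg r f
    unfold characteristic
    linarith
  -- Without poles, a convex kink makes `N(r, -f)` grow linearly, and Jensen carries this over to
  -- `T(r, f)`.
  by_cases hq : ∃ α, 0 < omega f α
  · obtain ⟨α, hα⟩ := hq
    refine ⟨omega f α / 2, by linarith, omega f α / 2 * |α| - f 0, ?_⟩
    filter_upwards [eventually_ge_atTop |α|] with r hr
    have h₁ := le_counting (exists_hasSlopes_neg hf) (α := α)
      (by rw [omega_neg hf]; linarith) hr
    rw [omega_neg hf, neg_neg] at h₁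
    have h₂ := jensen hf ((abs_nonneg α).trans hr)
    have h₃ : 1 / 2 * (f r + f (-r)) ≤ proximity r f := by
      unfold proximity
      linarith [le_max_right 0 (f r), le_max_right 0 (f (-r))]
    unfold characteristic
    linarith
  -- With no kinks at all `f` is affine with non-zero slope, and the proximity term is linear.
  · push Not at hp hq
    obtain ⟨m, c, h⟩ := exists_affine_on isOpen_univ isPreconnected_univ (f := f) fun x _ => by
      obtain ⟨l, r, h⟩ := hf x
      have : l = r := by linarith [h.omega_eq, hp x, hq x]
      exact ⟨l, this ▸ h⟩
    have hm : m ≠ 0 := by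
      rintro rfl
      exact hconst ⟨c, fun x => by rw [h x trivial]; ring⟩
    refine ⟨|m| / 2, by positivity, |c| / 2, ?_⟩
    filter_upwards [eventually_ge_atTop 0] with r hr
    have h₁ := counting_nonneg hf hr
    have h₂ : 1 / 2 * (|m| * r - |c|) ≤ proximity r f := by
      unfold proximity
      rw [h r trivial, h (-r) trivial]
      have h₃ := le_max_left 0 (m * r + c)
      have h₄ := le_max_left 0 (m * -r + c)
      have h₅ := le_max_right 0 (m * r + c)
      have h₆ := le_max_right 0 (m * -r + c)
      have h₇ := neg_abs_le c
      rcases abs_cases m with ⟨e, -⟩ | ⟨e, -⟩ <;> rw [e] <;> linarith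
    unfold characteristic
    linarith

theorem hyperOrder_nonneg {c : ℝ} (hc : 0 < c)
    (h : ∀ᶠ r in atTop, c * r ≤ characteristic r f) : 0 ≤ hyperOrder f := by
  unfold hyperOrder
  calc (0 : EReal) = limsup (fun _ : ℝ => (0 : EReal)) atTop := by simp
    _ ≤ _ := by
      refine limsup_le_limsup ?_
      filter_upwards [h, (tendsto_id.const_mul_atTop hc).eventually_ge_atTop (Real.exp 1),
        eventually_ge_atTop 1] with r h₁ h₂ h₃
      have h₄ : Real.exp 1 ≤ characteristic r f := h₂.trans h₁
      have h₅ : 1 ≤ Real.log (characteristic r f) :=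
        (Real.le_log_iff_exp_le ((Real.exp_pos 1).trans_le h₄)).2 h₄
      exact EReal.coe_nonneg.2 (div_nonneg (Real.log_nonneg h₅) (Real.log_nonneg h₃))

/-! ### Truncation and the bounded error. -/

theorem exists_hasSlopes_max (hf : ∀ x, ∃ l r, HasSlopes f x l r) (a x : ℝ) :
    ∃ l r, HasSlopes (fun y => max (f y) a) x l r := by
  obtain ⟨l, r, h⟩ := hf x
  obtain ⟨l', r', h', -⟩ := h.max_const a
  exact ⟨l', r', h'⟩

/-- Truncating below all poles does not change the counting function. -/
theorem counting_max (hf : ∀ x, ∃ l r, HasSlopes f x l r) {a : ℝ}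
    (ha : ∀ α, omega f α < 0 → a < f α) {r : ℝ} (hr : 0 ≤ r) :
    counting r (fun x => max (f x) a) = counting r f := by
  have hω : ∀ s, max 0 (-omega (fun x => max (f x) a) s) = max 0 (-omega f s) := by
    intro s
    obtain ⟨l, r, h⟩ := hf s
    obtain ⟨l', r', h', ⟨-, e⟩ | ⟨hle, e⟩⟩ := h.max_const a
    · rw [h.omega_eq, h'.omega_eq, e]
    · rw [h'.omega_eq, max_eq_left (by linarith), max_eq_left]
      by_contra hlt
      exact absurd (ha s (by linarith)) (not_lt.2 hle)
  obtain ⟨F, hF⟩ := exists_finset_breaks hf r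
  obtain ⟨G, hG⟩ := exists_finset_breaks (exists_hasSlopes_max hf a) r
  classical
  rw [counting_eq_sum (F := F ∪ G) hr fun s h h' => Finset.mem_union_right _ (hG s h h'),
    counting_eq_sum (F := F ∪ G) hr fun s h h' => Finset.mem_union_left _ (hF s h h')]
  simp only [hω]

theorem abs_characteristic_sub_counting_le (hf : ∀ x, ∃ l r, HasSlopes f x l r) {a : ℝ}
    (ha : ∀ α, omega f α < 0 → a < f α) {r : ℝ} (hr : 0 ≤ r) :
    |characteristic r f - counting r (fun x => tropDiv tropOne (tropAdd (f x) a))|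
      ≤ |a| + |max (f 0) a| := by
  have h₁ := jensen (exists_hasSlopes_max hf a) hr
  simp only [counting_max hf ha hr] at h₁
  simp only [tropDiv, tropOne, tropAdd, zero_sub]
  -- The map `t ↦ max t u` is 1-Lipschitz.
  have hb : ∀ u, |max 0 u - max u a| ≤ |a| := fun u => by
    have := abs_max_sub_max_le_abs 0 a u
    rwa [zero_sub, abs_neg, max_comm a u] at this
  have h₂ := abs_le.1 (hb (f r))
  have h₃ := abs_le.1 (hb (f (-r)))
  have h₄ := neg_abs_le (max (f 0) a)
  have h₅ := le_abs_self (max (f 0) a)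
  unfold characteristic proximity
  rw [abs_le]
  constructor <;> linarith

theorem tendsto_characteristic_div_rpow {c p : ℝ} (hc : 0 < c) (hp : p < 1)
    (h : ∀ᶠ r in atTop, c * r ≤ characteristic r f) :
    Tendsto (fun r => characteristic r f / r ^ p) atTop atTop := by
  refine tendsto_atTop_mono' _ ?_
    ((tendsto_rpow_atTop (y := 1 - p) (by linarith)).const_mul_atTop hc)
  filter_upwards [h, eventually_gt_atTop 0] with r h₁ hr
  rw [le_div_iff₀ (Real.rpow_pos_of_pos hr p), mul_assoc, ← Real.rpow_add hr, sub_add_cancel,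
    Real.rpow_one]
  exact h₁

end TropicalNevanlinna

theorem corollary7p2 (f : ℝ → ℝ) (hf : IsTropicalMeromorphic f)
    (hconst : ¬ ∃ c : ℝ, ∀ x : ℝ, f x = c)
    (ς : ℝ) (horder : hyperOrder f = (ς : EReal)) (hς : ς < 1)
    (ε : ℝ) (hε : 0 < ε)
    (q : ℕ) (hq : 1 ≤ q) (a : Fin q → ℝ) (ha : Function.Injective a)
    (hpoles : ∀ k : Fin q, (a k : EReal) < ⨅ α ∈ poles f, (f α : EReal)) :
    ∃ E : Set ℝ, FiniteLogMeasure E ∧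
      (fun r : ℝ => (q : ℝ) * characteristic r f
          - ∑ k : Fin q, counting r (fun x => tropDiv tropOne (tropAdd (f x) (a k))))
        =o[atTop ⊓ 𝓟 Eᶜ]
      (fun r : ℝ => characteristic r f / r ^ (1 - ς - ε)) := by
  have hs := hf.exists_hasSlopes
  obtain ⟨c, hc, hT⟩ := exists_linear_le_characteristic hs hconst
  have hς₀ : 0 ≤ ς := by
    have := hyperOrder_nonneg hc hT
    rw [horder] at this
    exact EReal.coe_nonneg.1 this
  have hlt : ∀ k α, omega f α < 0 → a k < f α := fun k α hα =>
    EReal.coe_lt_coe_iff.1 ((hpoles k).trans_le (iInf₂_le α hα))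
  -- The error is bounded for all `r ≥ 0`, so nothing has to be excluded.
  refine ⟨∅, ⟨MeasurableSet.empty, by simp⟩, ?_⟩
  rw [Set.compl_empty, principal_univ, inf_top_eq]
  refine IsBigO.trans_isLittleO (g := fun _ => (1 : ℝ)) ?_ ?_
  · refine IsBigO.of_bound (∑ k, (|a k| + |max (f 0) (a k)|)) ?_
    filter_upwards [eventually_ge_atTop 0] with r hr
    rw [norm_one, mul_one, Real.norm_eq_abs]
    calc _ = |∑ k, (characteristic r f
          - counting r (fun x => tropDiv tropOne (tropAdd (f x) (a k))))| := by
          rw [Finset.sum_sub_distrib, Finset.sum_const, Finset.card_univ, Fintype.card_fin,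
            nsmul_eq_mul]
      _ ≤ _ := (Finset.abs_sum_le_sum_abs _ _).trans (Finset.sum_le_sum fun k _ =>
          abs_characteristic_sub_counting_le hs (hlt k) hr)
  · rw [isLittleO_one_left_iff]
    exact tendsto_norm_atTop_atTop.comp
      (tendsto_characteristic_div_rpow hc (by linarith) hT)
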